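/- Let $n\ge 0$ and let $p\ge 1$ be integers, and let $f:\mathbb{R}^n\to\mathbb{R}\cup\{+\infty\}$ have domain $\mathrm{dom} f=\{x: f(x)<+\infty\}$ and graph $\mathrm{Graph} f=\{(x,f(x)) : x\in\mathrm{dom} f\}\subset\mathbb{R}^{n}\times\mathbb{R}=\mathbb{R}^{n+1}$. Assume that $\mathrm{Graph} f$ is closed in $\mathbb{R}^{n+1}$ and admits a $C^p$-Whitney stratification $(S_i)_{i\in I}$ satisfying $$(\mathcal H)\qquad e_{n+1}=(0,\dots,0,1)\notin T_uS_i\quad\text{for all } i\in I,\ u\in S_i .$$ That is: $(S_i)_{i\in I}$ is a locally finite partition of $\mathrm{Graph} f$ into (nonempty) $C^p$ submanifolds of $\mathbb{R}^{n+1}$; for $i\ne j$, $\overline{S_i}\cap S_j\neq\emptyset$ implies $S_j\subset\overline{S_i}\setminus S_i$; and (Whitney-(a)) for $i\neq j$ and $u\in\overline{S_i}\cap S_j$, if $u_k\in S_i$, $u_k\to u$ and $T_{u_k}S_i\to\mathcal T$ for a vector subspace $\mathcal T$, then $T_uS_j\subset\mathcal T$. Here $V_k\to\mathcal T$ means $D(V_k,\mathcal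 T)\to0$, where $D(V,W)=\max\{\sup_{v\in V,\|v\|=1}d(v,W),\ \sup_{w\in W,\|w\|=1}d(w,V)\}$ and a supremum over the empty set is $0$. For $x\in\mathrm{dom} f$ the Fréchet subdifferential $\hat\partial f(x)$ is the set of $x^*\in\mathbb{R}^n$ with $\liminf_{y\to x,\,y\ne x}\frac{f(y)-f(x)-\langle x^*,y-x\rangle}{\|y-x\|}\ge 0$ (and $\hat\partial f(x)=\emptyset$ for $x\notin\mathrm{dom} f$). For $x\in\mathrm{dom} f$ the limiting subdifferential $\partial f(x)$ is the set of all $\lim x_k^*$, and the asymptotic limiting subdifferential $\partial^\infty f(x)$ the set of all $\lim t_kx_k^*$ with $t_k\searrow0^+$, where $x_k^*\in\hat\partial f(x_k)$, $x_k\to x$ and $f(x_k)\to f(x)$. The Clarke subdifferential $\partial^\circ f(x)$ is the closed convex hull of $\partial f(x)+\partial^\infty f(x)$ if $x\in\mathrm{dom} f$, and is empty otherwise. A number $\alpha\in\mathbb{R}$ is a Clarke critical value of $f$ if $\alpha=f(x)$ for some $x$ with $0\in\partial^\circ f(x)$. For $x\in\mathrm{dom} f$ let $S_x$ be the stratum containing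 $(x,f(x))$ and let $X_x=\Pi(S_x)$, where $\Pi:\mathbb{R}^{n+1}\to\mathbb{R}^n$ is $\Pi(x,t)=x$. Give $X_x$ the manifold structure that makes $\Pi:S_x\to X_x$ a diffeomorphism (the usual structure if $X_x$ is an embedded submanifold and $f|_{X_x}$ is continuous) and the Riemannian metric induced by $\mathbb{R}^n$, and let $\nabla_R f(x)\in T_xX_x$ be the gradient at $x$ of $f|_{X_x}$. This gradient exists and is unique. Moreover: (i) for all $x\in\mathrm{dom} f$ and all $x^*\in\partial^\circ f(x)$, $\ \|\nabla_Rf(x)\|\le\|x^*\|$; (ii) (Morse–Sard) if $p\ge n$, then the set of Clarke critical values of $f$ has Lebesgue measure $0$ in $\mathbb{R}$. -/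

import Mathlib

open Filter Topology MeasureTheory
open scoped Pointwise

noncomputable section

namespace WhitneySard

/-! ### Submanifolds, tangent spaces and stratifications -/

section Stratification

variable {E : Type*} [NormedAddCommGroup E] [NormedSpace ℝ E]

/-- `M` is an (embedded) `C^p` submanifold of `E`: for some dimension `d`, near each of its points
a `C^p` diffeomorphism between open subsets of `E` carries `M` to a `d`-dimensional vector
subspace. -/
def IsSubmanifold (p : ℕ) (M : Set E) : Prop :=
  ∃ d : ℕ, ∀ x ∈ M, ∃ (φ : OpenPartialHomeomorph E E) (V : Submodule ℝ E),
    x ∈ φ.source ∧ ContDiffOn ℝ p φ φ.source ∧ ContDiffOn ℝ p φ.symm φ.target ∧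
    Module.finrank ℝ V = d ∧ ∀ y ∈ φ.source, φ y ∈ V ↔ y ∈ M

/-- The tangent space `T_x M`: the space of velocities `c'(0)` of the curves `c` in `M`
with `c 0 = x`. (For a submanifold and `x ∈ M` the velocities already form a subspace.) -/
def tangentSpace (M : Set E) (x : E) : Submodule ℝ E :=
  Submodule.span ℝ {v : E | ∃ c : ℝ → E,
    c 0 = x ∧ (∀ᶠ t in 𝓝 (0 : ℝ), c t ∈ M) ∧ HasDerivAt c v 0}

/-- The one-sided gap `sup_{v ∈ V, ‖v‖ = 1} d(v, W)`, equal to `0` if `V = 0`. The family is bounded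
by `1`, so the supremum is a genuine one. -/
def semiGap (V W : Submodule ℝ E) : ℝ :=
  ⨆ v : {v : E // v ∈ V ∧ ‖v‖ = 1}, Metric.infDist (v : E) (W : Set E)

/-- The distance (gap) of two vector subspaces. -/
def gap (V W : Submodule ℝ E) : ℝ :=
  max (semiGap V W) (semiGap W V)

/-- `(X i)` is a `C^p` stratification of `A`: a locally finite partition of `A` into
`C^p` submanifolds such that, for `i ≠ j`, if `closure (X i)` meets `X j`
then `X j ⊆ closure (X i) \ X i`. -/
structure IsStratification {ι : Type*} (p : ℕ) (X : ι → Set E) (A : Set E) : Prop where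
  nonempty : ∀ i, (X i).Nonempty
  disjoint : ∀ i j, i ≠ j → Disjoint (X i) (X j)
  iUnion_eq : ⋃ i, X i = A
  locallyFinite : LocallyFinite X
  isSubmanifold : ∀ i, IsSubmanifold p (X i)
  frontier : ∀ i j, i ≠ j → (closure (X i) ∩ X j).Nonempty → X j ⊆ closure (X i) \ X i

/-- The Whitney-(a) property. -/
def WhitneyA {ι : Type*} (X : ι → Set E) : Prop :=
  ∀ i j, i ≠ j → ∀ x ∈ closure (X i) ∩ X j, ∀ (u : ℕ → E) (T : Submodule ℝ E),
    (∀ k, u k ∈ X i) → Tendsto u atTop (𝓝 x) →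
    Tendsto (fun k => gap (tangentSpace (X i) (u k)) T) atTop (𝓝 0) →
    tangentSpace (X j) x ≤ T

/-- `(X i)` is a `C^p`-Whitney stratification of `A`. -/
def IsWhitneyStratification {ι : Type*} (p : ℕ) (X : ι → Set E) (A : Set E) : Prop :=
  IsStratification p X A ∧ WhitneyA X

end Stratification

/-! ### Extended-real-valued functions on `ℝⁿ` and their subdifferentials -/

/-- `ℝⁿ` with its Euclidean structure. -/
abbrev Rn (n : ℕ) : Type := EuclideanSpace ℝ (Fin n)

/-- `ℝⁿ⁺¹ = ℝⁿ × ℝ` with its Euclidean structure. -/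
abbrev RnR (n : ℕ) : Type := WithLp 2 (Rn n × ℝ)

variable {n : ℕ}

/-- The domain of `f`. -/
def dom (f : Rn n → EReal) : Set (Rn n) := {x | f x < ⊤}

/-- The graph of `f`: the points `(x, f x)` of `ℝⁿ × ℝ` with `f x` finite. -/
def graph (f : Rn n → EReal) : Set (RnR n) := {u | f u.fst = ((u.snd : ℝ) : EReal)}

/-- The point `(x, f x)`, for `f x` finite. -/
def graphPoint (f : Rn n → EReal) (x : Rn n) : RnR n := WithLp.toLp 2 (x, (f x).toReal)

/-- The last vector `e_{n+1} = (0, …, 0, 1)` of the canonical basis of `ℝⁿ⁺¹`. -/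
def lastVec (n : ℕ) : RnR n := WithLp.toLp 2 (0, 1)

/-- Condition (H): `e_{n+1}` is tangent to no stratum. -/
def Transversal {ι : Type*} (S : ι → Set (RnR n)) : Prop :=
  ∀ i, ∀ u ∈ S i, lastVec n ∉ tangentSpace (S i) u

/-- The Fréchet subdifferential. The quotients live in `[-∞, +∞]`, where every lower limit exists. -/
def frechetSubdiff (f : Rn n → EReal) (x : Rn n) : Set (Rn n) :=
  {xs | x ∈ dom f ∧
    0 ≤ liminf (fun y : Rn n =>
      (f y - f x - ((inner ℝ xs (y - x) : ℝ) : EReal)) / ((‖y - x‖ : ℝ) : EReal)) (𝓝[≠] x)}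

/-- The limiting subdifferential. -/
def limitingSubdiff (f : Rn n → EReal) (x : Rn n) : Set (Rn n) :=
  {q | x ∈ dom f ∧ ∃ (y ys : ℕ → Rn n),
    (∀ k, ys k ∈ frechetSubdiff f (y k)) ∧ Tendsto y atTop (𝓝 x) ∧
    Tendsto (fun k => f (y k)) atTop (𝓝 (f x)) ∧ Tendsto ys atTop (𝓝 q)}

/-- The asymptotic limiting subdifferential. -/
def asymptoticSubdiff (f : Rn n → EReal) (x : Rn n) : Set (Rn n) :=
  {q | x ∈ dom f ∧ ∃ (y ys : ℕ → Rn n) (t : ℕ → ℝ),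
    (∀ k, ys k ∈ frechetSubdiff f (y k)) ∧
    (∀ k, 0 < t k) ∧ Antitone t ∧ Tendsto t atTop (𝓝 0) ∧ Tendsto y atTop (𝓝 x) ∧
    Tendsto (fun k => f (y k)) atTop (𝓝 (f x)) ∧ Tendsto (fun k => t k • ys k) atTop (𝓝 q)}

/-- The Clarke subdifferential: the closed convex hull of `∂f(x) + ∂^∞f(x)`
(empty for `x ∉ dom f`, both summands being empty then). -/
def clarkeSubdiff (f : Rn n → EReal) (x : Rn n) : Set (Rn n) :=
  closure (convexHull ℝ (limitingSubdiff f x + asymptoticSubdiff f x))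

/-- The Clarke critical values of `f`. -/
def clarkeCriticalValues (f : Rn n → EReal) : Set ℝ :=
  {α | ∃ x, f x = (α : EReal) ∧ 0 ∈ clarkeSubdiff f x}

/-! ### The gradient of `f` along a stratum

Let `S ⊆ graph f` be a stratum and `X = Π(S)` its projection to `ℝⁿ`, with the manifold structure
which makes `Π : S → X` a diffeomorphism. A curve `c` in `X` is continuous for the topology of this
manifold iff `c` and `f ∘ c` are continuous. (If `f` is continuous on `X` for the topology of `ℝⁿ`,
this is just continuity of `c`; then `X` is an embedded submanifold of `ℝⁿ`, and the notions below
are the tangent space and the gradient of `f|_X` in the usual sense.) -/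

/-- `c` is a curve in the manifold `X = Π(S)`, with `c 0 = x` and velocity `w` at `0`. -/
structure IsCurve (f : Rn n → EReal) (S : Set (RnR n)) (x : Rn n) (c : ℝ → Rn n) (w : Rn n) :
    Prop where
  map_zero : c 0 = x
  mem : ∀ᶠ t in 𝓝 (0 : ℝ), c t ∈ (fun u : RnR n => u.fst) '' S
  hasDerivAt : HasDerivAt c w 0
  continuousAt : ContinuousAt (fun t => (f (c t)).toReal) 0

/-- The tangent space `T_x X` of `X = Π(S)` at `x`. -/
def projTangentSpace (f : Rn n → EReal) (S : Set (RnR n)) (x : Rn n) : Submodule ℝ (Rn n) :=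
  Submodule.span ℝ {w | ∃ c, IsCurve f S x c w}

/-- `v` is the (Riemannian) gradient at `x` of the restriction of `f` to the manifold `X = Π(S)`,
which carries the metric induced by `ℝⁿ`: `v` is tangent to `X` and `f` has derivative `⟨v, c'(0)⟩`
along every curve `c` in `X` through `x`. -/
def IsRiemannianGradient (f : Rn n → EReal) (S : Set (RnR n)) (x v : Rn n) : Prop :=
  v ∈ projTangentSpace f S x ∧
  ∀ c w, IsCurve f S x c w → HasDerivAt (fun t => (f (c t)).toReal) (inner ℝ v w) 0

end WhitneySard

end

/-! The core is a projection formula: if `v` is the gradient of `f` along the stratum through `(x, f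
x)`, every Clarke subgradient at `x` differs from `v` by a vector normal to the projected stratum. A
Fréchet subgradient `x*` makes `(x*, -1)` normal to the stratum at its base point
(`mem_orthogonal_of_mem_frechetSubdiff`). Whitney-(a) preserves normality in the limit
(`IsWhitneyStratification.mem_orthogonal_of_tendsto`), so a limiting subgradient `q` gives the
normal `(q, -1)` and an asymptotic one gives `(q, 0)`. Since `(v, -1)` is normal too, subtracting it
and projecting puts all these vectors, and then their closed convex hull, where the formula wants
them (`sub_mem_orthogonal_of_mem_clarkeSubdiff`). Hence `v` is the orthogonal projection of each
Clarke subgradient, which is (i). Condition (H) makes the projection of a stratum an immersion, so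
that the gradient exists.

For (ii), a Clarke critical point has `v = 0` by (i), so the tangent space of its stratum is
horizontal and its value is a critical value of the height function on that stratum. A stratum is
`C^p` of dimension at most `n ≤ p`, and there are countably many strata, so Sard's theorem for real
functions applies. That theorem comes from A. P. Morse's lemma `flatCover_self` and a Hausdorff
measure estimate. -/

namespace WhitneySard

/-! ### Measure estimates and calculus for Sard's theorem -/

section Sard

open Metric ENNReal NNReal

/-- A map that is `C`-Hölder of exponent `m` at small scales on `s ⊆ ℝᵐ` increases volume at most by
the factor `C`. -/
theorem volume_image_le_of_forall_dist_lt {m : ℕ} (hm : 0 < m) (g : (Fin m → ℝ) → ℝ)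
    (s : Set (Fin m → ℝ)) (C : ℝ≥0) {δ : ℝ} (hδ : 0 < δ)
    (h : ∀ x ∈ s, ∀ y ∈ s, dist x y < δ → dist (g x) (g y) ≤ C * dist x y ^ m) :
    volume (g '' s) ≤ C * volume s := by
  have : Nonempty (Fin m) := ⟨⟨0, hm⟩⟩
  set b : ℕ → Set (Fin m → ℝ) := fun k => ball (TopologicalSpace.denseSeq (Fin m → ℝ) k) (δ / 2)
    with hb
  have hU : ⋃ k, b k = Set.univ := by
    refine Set.eq_univ_of_forall fun x => ?_
    obtain ⟨k, hk⟩ :=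
      (TopologicalSpace.denseRange_denseSeq (Fin m → ℝ)).exists_dist_lt x (half_pos hδ)
    exact Set.mem_iUnion.2 ⟨k, hk⟩
  -- The set `s` need not be measurable: the disjoint measurable pieces `t k` still split its outer
  -- measure additively, and any two points of one piece are less than `δ` apart.
  set t := disjointed b with ht
  have htm : ∀ k, MeasurableSet (t k) := fun k => .disjointed (fun _ => measurableSet_ball) k
  have htU : ⋃ k, t k = Set.univ := by rw [ht, iUnion_disjointed, hU]
  have piece : ∀ k, volume (g '' (s ∩ t k)) ≤ C * volume (s ∩ t k) := by
    intro k
    have hH : HolderOnWith C (m : ℝ≥0) g (s ∩ t k) := by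
      intro x hx y hy
      have hx' : x ∈ b k := disjointed_subset _ _ hx.2
      have hy' : y ∈ b k := disjointed_subset _ _ hy.2
      have hd : dist x y < δ := by
        have := dist_triangle_right x y (TopologicalSpace.denseSeq (Fin m → ℝ) k)
        rw [hb, mem_ball] at hx' hy'
        linarith
      have := h x hx.1 y hy.1 hd
      rw [edist_dist, edist_dist]
      simp only [NNReal.coe_natCast, ENNReal.rpow_natCast]
      rw [← ENNReal.ofReal_pow dist_nonneg, ← ENNReal.ofReal_coe_nnreal,
        ← ENNReal.ofReal_mul C.coe_nonneg]
      exact ENNReal.ofReal_le_ofReal this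
    have := hH.hausdorffMeasure_image_le (by exact_mod_cast hm) (d := 1) zero_le_one
    -- For the sup metric, `m`-dimensional Hausdorff measure is exactly Lebesgue measure, so no
    -- dimensional constant enters.
    have e : (μH[((m : ℝ≥0) : ℝ) * 1] : Measure (Fin m → ℝ)) = volume := by
      have := hausdorffMeasure_pi_real (ι := Fin m)
      simpa using this
    rwa [e, hausdorffMeasure_real, ENNReal.rpow_one] at this
  calc volume (g '' s) ≤ volume (⋃ k, g '' (s ∩ t k)) := by
        rw [← Set.image_iUnion, ← Set.inter_iUnion, htU, Set.inter_univ]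
    _ ≤ ∑' k, volume (g '' (s ∩ t k)) := measure_iUnion_le _
    _ ≤ ∑' k, C * volume (s ∩ t k) := ENNReal.tsum_le_tsum piece
    _ = C * volume s := by
        rw [ENNReal.tsum_mul_left]
        congr 1
        have := measure_iUnion (μ := volume.restrict s) (disjoint_disjointed b) htm
        rw [← ht, htU, Measure.restrict_apply_univ] at this
        rw [this]
        exact tsum_congr fun k => by rw [Measure.restrict_apply (htm k), Set.inter_comm]

/-- For each `C > 0`, the points where the Hölder bound with constant `C` holds at scale `1 / (j +
1)` increase to all of `B`. So the image of a bounded part of `B` has measure at most `C` times a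
finite volume; then `C → 0`. -/
theorem volume_image_eq_zero_of_isLittleO_pow {m : ℕ} (g : (Fin m → ℝ) → ℝ)
    (B : Set (Fin m → ℝ))
    (h : ∀ x ∈ B, (fun y => g y - g x) =o[𝓝 x] fun y => ‖y - x‖ ^ m) :
    volume (g '' B) = 0 := by
  rcases m.eq_zero_or_pos with rfl | hm
  · exact (Set.subsingleton_of_subsingleton (s := B)).image g |>.measure_zero _
  suffices H : ∀ R : ℕ, volume (g '' (B ∩ ball 0 R)) = 0 by
    have : g '' B = ⋃ R : ℕ, g '' (B ∩ ball 0 R) := by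
      rw [← Set.image_iUnion, ← Set.inter_iUnion, iUnion_ball_nat, Set.inter_univ]
    rw [this]
    exact measure_iUnion_null H
  intro R
  set D := B ∩ ball (0 : Fin m → ℝ) R
  have hfin : volume D ≠ ∞ := ((measure_mono Set.inter_subset_right).trans_lt
    measure_ball_lt_top).ne
  have key : ∀ C : ℝ≥0, 0 < C → volume (g '' D) ≤ C * volume D := by
    intro C hC
    set s : ℕ → Set (Fin m → ℝ) := fun j => {x ∈ D | ∀ y, dist x y < 1 / (j + 1 : ℝ) →
      dist (g x) (g y) ≤ C * dist x y ^ m} with hs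
    have hmono : Monotone s := by
      intro i j hij x hx
      refine ⟨hx.1, fun y hy => hx.2 y (hy.trans_le ?_)⟩
      exact Nat.one_div_le_one_div hij
    have hsU : ⋃ j, s j = D := by
      refine Set.Subset.antisymm (Set.iUnion_subset fun j x hx => hx.1) fun x hx => ?_
      have := (h x hx.1).def (c := C) (by exact_mod_cast hC)
      obtain ⟨ε, hε, hball⟩ := Metric.eventually_nhds_iff.1 this
      obtain ⟨j, hj⟩ := exists_nat_one_div_lt hε
      refine Set.mem_iUnion.2 ⟨j, hx, fun y hy => ?_⟩
      have := hball (y := y) (by rw [dist_comm]; exact hy.trans hj)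
      rw [norm_pow, norm_norm, ← dist_eq_norm, ← dist_eq_norm, dist_comm (g y), dist_comm y] at this
      exact this
    -- Continuity from below holds for outer measure, so the images need not be measurable.
    rw [← hsU, Set.image_iUnion, Monotone.measure_iUnion (fun i j hij => Set.image_mono (hmono hij))]
    refine iSup_le fun j => ?_
    rw [hsU]
    refine (volume_image_le_of_forall_dist_lt hm g (s j) C Nat.one_div_pos_of_nat
      fun x hx y _ hxy => hx.2 y hxy).trans ?_
    gcongr
    exact fun x hx => hx.1
  by_contra hne
  have hlim : Tendsto (fun C : ℝ≥0 => (C : ℝ≥0∞) * volume D) (𝓝[>] 0) (𝓝 0) := by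
    have : Tendsto (fun C : ℝ≥0 => (C : ℝ≥0∞) * volume D) (𝓝 0) (𝓝 ((0 : ℝ≥0) * volume D)) :=
      ENNReal.Tendsto.mul_const (ENNReal.tendsto_coe.2 tendsto_id) (Or.inr hfin)
    simpa using this.mono_left nhdsWithin_le_nhds
  exact hne (le_antisymm (ge_of_tendsto hlim
    (eventually_mem_nhdsWithin.mono fun C hC => key C hC)) zero_le)

/-- If the derivative of `f` along `ψ` is `o(‖y - x‖ ^ k)`, then `f` itself is constant along `ψ`
up to `o(‖y - x‖ ^ (k + 1))`. -/
theorem isLittleO_pow_succ_of_fderiv {F E G : Type*} [NormedAddCommGroup F] [NormedSpace ℝ F]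
    [NormedAddCommGroup E] [NormedSpace ℝ E] [NormedAddCommGroup G] [NormedSpace ℝ G]
    {ψ : F → E} {f : E → G} {x : F} {k : ℕ} (hψ : ContDiffAt ℝ 1 ψ x) (hf : ContDiffAt ℝ 1 f (ψ x))
    (h : (fun y => fderiv ℝ f (ψ y)) =o[𝓝 x] fun y => ‖y - x‖ ^ k) :
    (fun y => f (ψ y) - f (ψ x)) =o[𝓝 x] fun y => ‖y - x‖ ^ (k + 1) := by
  have hψd : ∀ᶠ y in 𝓝 x, DifferentiableAt ℝ ψ y :=
    (hψ.eventually (by simp)).mono fun y hy => hy.differentiableAt (by simp)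
  have hfd : ∀ᶠ y in 𝓝 x, DifferentiableAt ℝ f (ψ y) :=
    hψ.continuousAt.eventually
      ((hf.eventually (by simp)).mono fun y hy => hy.differentiableAt (by simp))
  obtain ⟨M, hM0, hM⟩ : ∃ M : ℝ, 0 < M ∧ ∀ᶠ y in 𝓝 x, ‖fderiv ℝ ψ y‖ ≤ M := by
    have hc : ContinuousAt (fderiv ℝ ψ) x := (hψ.fderiv_right (m := 0) (by simp)).continuousAt
    refine ⟨‖fderiv ℝ ψ x‖ + 1, by positivity, ?_⟩
    exact (hc.norm.eventually_lt continuousAt_const (by simp)).mono fun y hy => hy.le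
  rw [Asymptotics.isLittleO_iff]
  intro c hc
  -- The factor `1 / M` absorbs the bound on `fderiv ℝ ψ` in the chain rule.
  have h' := h.def (c := c / M) (by positivity)
  obtain ⟨ε, hε, hball⟩ := Metric.eventually_nhds_iff.1 (hψd.and (hfd.and (hM.and h')))
  filter_upwards [Metric.ball_mem_nhds x hε] with y hy
  have hsub : ∀ z ∈ closedBall x (dist y x), dist z x < ε := fun z hz =>
    (mem_closedBall.1 hz).trans_lt hy
  have hder : ∀ z ∈ closedBall x (dist y x),
      HasFDerivWithinAt (fun z => f (ψ z)) ((fderiv ℝ f (ψ z)).comp (fderiv ℝ ψ z))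
        (closedBall x (dist y x)) z := by
    intro z hz
    obtain ⟨h1, h2, -⟩ := hball (hsub z hz)
    exact (h2.hasFDerivAt.comp z h1.hasFDerivAt).hasFDerivWithinAt
  have hbd : ∀ z ∈ closedBall x (dist y x),
      ‖(fderiv ℝ f (ψ z)).comp (fderiv ℝ ψ z)‖ ≤ c * ‖y - x‖ ^ k := by
    intro z hz
    obtain ⟨-, -, h3, h4⟩ := hball (hsub z hz)
    have hzy : ‖z - x‖ ≤ ‖y - x‖ := by
      rw [← dist_eq_norm, ← dist_eq_norm]; exact hz
    calc _ ≤ ‖fderiv ℝ f (ψ z)‖ * ‖fderiv ℝ ψ z‖ := ContinuousLinearMap.opNorm_comp_le _ _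
      _ ≤ (c / M * ‖z - x‖ ^ k) * M := by
        gcongr
        simpa using h4
      _ = c * ‖z - x‖ ^ k := by field_simp
      _ ≤ c * ‖y - x‖ ^ k := by gcongr
  have := (convex_closedBall x (dist y x)).norm_image_sub_le_of_norm_hasFDerivWithin_le hder hbd
    (mem_closedBall_self dist_nonneg) (mem_closedBall.2 le_rfl)
  rw [norm_pow, norm_norm, pow_succ, ← mul_assoc]
  exact this

/-- Near a zero `x` of a `C^k` function `f` with nonzero derivative, a set on which `f` vanishes is
contained in a `C^k`-parametrized hypersurface. -/
theorem exists_param_of_fderiv_ne_zero {E : Type*} [NormedAddCommGroup E] [NormedSpace ℝ E]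
    [FiniteDimensional ℝ E] {k : ℕ} (hk : k ≠ 0) {f : E → ℝ} {x : E} {A : Set E}
    (hf : ContDiffAt ℝ k f x) (hA : ∀ a ∈ A, f a = 0) (hfx : fderiv ℝ f x ≠ 0) :
    ∃ (K : Submodule ℝ E) (ψ : K → E) (B : Set K) (N : Set E), N ∈ 𝓝 x ∧
      Module.finrank ℝ K + 1 = Module.finrank ℝ E ∧
      (∀ z ∈ B, ψ z ∈ A ∧ ContDiffAt ℝ k ψ z) ∧ A ∩ N ⊆ ψ '' B := by
  have hk' : (k : WithTop ℕ∞) ≠ 0 := by exact_mod_cast hk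
  have hsurj : Function.Surjective (fderiv ℝ f x) :=
    LinearMap.surjective (f := (fderiv ℝ f x : E →ₗ[ℝ] ℝ)) (by exact_mod_cast hfx)
  have hr : (fderiv ℝ f x).range = ⊤ := LinearMap.range_eq_top.2 hsurj
  set φ := HasStrictFDerivAt.implicitFunctionDataOfComplemented f (fderiv ℝ f x)
    (hf.hasStrictFDerivAt hk') hr
      (fderiv ℝ f x).ker_closedComplemented_of_finiteDimensional_range with hφ
  have hr' : ContDiffAt ℝ k φ.rightFun φ.pt := by
    simp only [hφ, HasStrictFDerivAt.implicitFunctionDataOfComplemented]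
    fun_prop
  have hcd : ContDiffAt ℝ k φ.implicitFunction.uncurry (φ.prodFun φ.pt) :=
    ImplicitFunctionData.contDiffAt_implicitFunction (by exact hf) hr' hk'
  have hev : ∀ᶠ y in 𝓝 x, φ.implicitFunction (φ.leftFun y) (φ.rightFun y) = y :=
    φ.implicitFunction_apply_image
  have hcd' : ∀ᶠ y in 𝓝 x, ContDiffAt ℝ k φ.implicitFunction.uncurry (φ.prodFun y) :=
    φ.hasStrictFDerivAt.continuousAt.eventually (hcd.eventually (by simp))
  have hl : φ.leftFun = f := rfl
  -- The level set `f = 0` is parametrized by the kernel of the derivative; `B` collects the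
  -- parameters of the points of `A` where inversion and smoothness hold, both of which are true
  -- near `x`.
  refine ⟨(fderiv ℝ f x).ker, φ.implicitFunction 0,
    φ.rightFun '' (A ∩ {y | φ.implicitFunction (φ.leftFun y) (φ.rightFun y) = y ∧
      ContDiffAt ℝ k φ.implicitFunction.uncurry (φ.prodFun y)}), _, hev.and hcd', ?_, ?_, ?_⟩
  · have := LinearMap.finrank_range_add_finrank_ker (fderiv ℝ f x : E →ₗ[ℝ] ℝ)
    rw [show LinearMap.range (fderiv ℝ f x : E →ₗ[ℝ] ℝ) = ⊤ from hr, finrank_top,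
      Module.finrank_self] at this
    rw [← this, add_comm]
  · rintro _ ⟨y, ⟨hy, h1, h2⟩, rfl⟩
    have h0 : φ.leftFun y = 0 := hA y hy
    rw [h0] at h1
    refine ⟨by rwa [h1], ?_⟩
    have e : φ.implicitFunction 0 = φ.implicitFunction.uncurry ∘ fun z => ((0 : ℝ), z) := rfl
    rw [e]
    refine ContDiffAt.comp _ ?_ (by fun_prop)
    rw [ImplicitFunctionData.prodFun_apply, h0] at h2
    exact h2
  · rintro y ⟨hy, h⟩
    have h0 : φ.leftFun y = 0 := hA y hy
    exact ⟨φ.rightFun y, ⟨y, ⟨hy, h⟩, rfl⟩, by have := h.1; rwa [h0] at this⟩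

end Sard

/-! ### A. P. Morse's lemma and the Morse–Sard theorem -/

section Morse

/-- `A` is covered by countably many sets `ψ i '' B i ⊆ T`, `B i ⊆ ℝ^(m i)` with `m i ≤ d`, where
`ψ i` is `C¹` at the points of `B i`, such that every `C^k` function `f` vanishing on `T` satisfies
`f (ψ i y) = o(‖y - x‖ ^ k)` as `y → x`, for all `x ∈ B i`. -/
def FlatCover {E : Type} [NormedAddCommGroup E] [NormedSpace ℝ E] (k d : ℕ) (T A : Set E) : Prop :=
  ∃ (J : Type) (_ : Countable J) (m : J → ℕ) (ψ : ∀ i, (Fin (m i) → ℝ) → E)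
    (B : ∀ i, Set (Fin (m i) → ℝ)), (∀ i, m i ≤ d) ∧ A ⊆ ⋃ i, ψ i '' B i ∧
    ∀ i, ∀ x ∈ B i, ContDiffAt ℝ 1 (ψ i) x ∧ ψ i x ∈ T ∧
      ∀ (G : Type) [NormedAddCommGroup G] [NormedSpace ℝ G] (f : E → G),
        (∀ a ∈ T, f a = 0 ∧ ContDiffAt ℝ k f a) →
        (fun y => f (ψ i y)) =o[𝓝 x] fun y => ‖y - x‖ ^ k

namespace FlatCover

variable {E : Type} [NormedAddCommGroup E] [NormedSpace ℝ E] {k d : ℕ} {T A A' : Set E}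

theorem mono (h : FlatCover k d T A) (hA : A' ⊆ A) : FlatCover k d T A' := by
  obtain ⟨J, hJ, m, ψ, B, hm, hc, h⟩ := h
  exact ⟨J, hJ, m, ψ, B, hm, hA.trans hc, h⟩

theorem iUnion {J : Type} [Countable J] {A : J → Set E} (h : ∀ j, FlatCover k d T (A j)) :
    FlatCover k d T (⋃ j, A j) := by
  choose I hI m ψ B hm hc h using h
  refine ⟨Σ j, I j, inferInstance, fun i => m i.1 i.2, fun i => ψ i.1 i.2, fun i => B i.1 i.2,
    fun i => hm i.1 i.2, ?_, fun i => h i.1 i.2⟩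
  refine Set.iUnion_subset fun j x hx => ?_
  obtain ⟨i, hi⟩ := Set.mem_iUnion.1 (hc j hx)
  exact Set.mem_iUnion.2 ⟨⟨j, i⟩, hi⟩

theorem union (h : FlatCover k d T A) (h' : FlatCover k d T A') : FlatCover k d T (A ∪ A') := by
  rw [Set.union_eq_iUnion]
  exact iUnion fun b => by cases b <;> assumption

/-- If `f` vanishes on `T`, then `f ∘ φ` vanishes on `B` and is still `C^k` there, so its flatness
in the parameter space is flatness of `f`. This serves to lower the dimension on hypersurfaces. -/
theorem image {K : Type} [NormedAddCommGroup K] [NormedSpace ℝ K] {d' : ℕ} {B : Set K} {φ : K → E}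
    (h : FlatCover k d' B B) (hk : 1 ≤ k) (hd : d' ≤ d)
    (hφ : ∀ z ∈ B, φ z ∈ T ∧ ContDiffAt ℝ k φ z) : FlatCover k d T (φ '' B) := by
  obtain ⟨J, hJ, m, ψ, C, hm, hc, h⟩ := h
  refine ⟨J, hJ, m, fun i => φ ∘ ψ i, C, fun i => (hm i).trans hd, ?_, fun i x hx => ?_⟩
  · refine (Set.image_mono hc).trans ?_
    simp only [Set.image_iUnion, Set.image_comp]
    exact subset_rfl
  · obtain ⟨h1, h2, h3⟩ := h i x hx
    obtain ⟨h4, h5⟩ := hφ _ h2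
    refine ⟨(h5.of_le (by exact_mod_cast hk)).comp x h1, h4, fun G _ _ f hf => ?_⟩
    exact h3 G (f ∘ φ) fun z hz =>
      ⟨(hf _ (hφ z hz).1).1, (hf _ (hφ z hz).1).2.comp z (hφ z hz).2⟩

/-- If the derivatives of all `C^(k+1)` functions vanishing on `T` vanish on `A`, then `A` inherits
one more order of flatness. -/
theorem succ (h : FlatCover k d A A) (hAT : A ⊆ T)
    (hfd : ∀ (f : E → ℝ), (∀ a ∈ T, f a = 0 ∧ ContDiffAt ℝ (k + 1 : ℕ) f a) →
      ∀ a ∈ A, fderiv ℝ f a = 0) : FlatCover (k + 1) d T A := by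
  obtain ⟨J, hJ, m, ψ, B, hm, hc, h⟩ := h
  refine ⟨J, hJ, m, ψ, B, hm, hc, fun i x hx => ?_⟩
  obtain ⟨h1, h2, h3⟩ := h i x hx
  refine ⟨h1, hAT h2, fun G _ _ f hf => ?_⟩
  -- As `hfd` concerns real functions only, `f` is tested against continuous functionals on `G`.
  have hd : ∀ a ∈ A, fderiv ℝ f a = 0 := by
    intro a ha
    ext v
    refine (SeparatingDual.eq_zero_iff_forall_dual_eq_zero (R := ℝ) _).2 fun l => ?_
    have hl : fderiv ℝ (l ∘ f) a = 0 := hfd (l ∘ f) (fun b hb =>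
      ⟨by simp [(hf b hb).1], l.contDiff.contDiffAt.comp b (hf b hb).2⟩) a ha
    have hfa : DifferentiableAt ℝ f a := (hf a (hAT ha)).2.differentiableAt (by simp)
    rw [fderiv_comp a l.differentiableAt hfa, l.fderiv] at hl
    exact congrArg (fun L : E →L[ℝ] ℝ => L v) hl
  -- Order `k` flatness is applied to the derivative itself, with values in `E →L[ℝ] G`; this is why
  -- `FlatCover` allows arbitrary targets.
  have := isLittleO_pow_succ_of_fderiv h1 ((hf _ (hAT h2)).2.of_le (by simp)) (h3 _ (fderiv ℝ f)
    fun a ha => ⟨hd a ha, (hf a (hAT ha)).2.fderiv_right (by simp)⟩)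
  simpa [(hf _ (hAT h2)).1] using this

theorem zero [FiniteDimensional ℝ E] (hd : Module.finrank ℝ E = d) (A : Set E) :
    FlatCover 0 d A A := by
  have e : (Fin d → ℝ) ≃L[ℝ] E := ContinuousLinearEquiv.ofFinrankEq (by simp [hd])
  refine ⟨Unit, inferInstance, fun _ => d, fun _ => e, fun _ => e ⁻¹' A, fun _ => le_rfl, ?_,
    fun _ x hx => ⟨e.contDiff.contDiffAt, hx, fun G _ _ f hf => ?_⟩⟩
  · intro x hx
    exact Set.mem_iUnion.2 ⟨(), e.symm x, by simpa using hx, by simp⟩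
  · obtain ⟨h1, h2⟩ := hf _ hx
    simp only [pow_zero, Asymptotics.isLittleO_one_iff]
    have := h2.continuousAt.tendsto.comp e.continuous.continuousAt.tendsto
    rwa [h1] at this

end FlatCover

/-- **A. P. Morse's lemma**. -/
theorem flatCover_self (k : ℕ) : ∀ (d : ℕ) (E : Type) [NormedAddCommGroup E] [NormedSpace ℝ E]
    [FiniteDimensional ℝ E], Module.finrank ℝ E = d → ∀ A : Set E, FlatCover k d A A := by
  induction k with
  | zero => exact fun d E _ _ _ hd A => FlatCover.zero hd A
  | succ k ihk =>
    intro d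
    induction d using Nat.strong_induction_on with
    | _ d ihd =>
    intro E _ _ _ hd A
    -- Off `R` all relevant derivatives vanish, so induction on `k` applies through `succ`. Near a
    -- point of `R` the set `A` lies in a hypersurface, so induction on `d` applies; the Lindelöf
    -- property makes the cover countable.
    set R : Set E := {x ∈ A | ∃ f : E → ℝ, (∀ a ∈ A, f a = 0 ∧ ContDiffAt ℝ (k + 1 : ℕ) f a) ∧
      fderiv ℝ f x ≠ 0}
    have hsing : FlatCover (k + 1) d A (A \ R) := by
      refine (ihk d E hd (A \ R)).succ Set.sdiff_subset fun f hf a ha => ?_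
      by_contra hne
      exact ha.2 ⟨ha.1, f, hf, hne⟩
    have hreg : ∀ x ∈ R, ∃ N ∈ 𝓝 x, FlatCover (k + 1) d A (A ∩ N) := by
      rintro x ⟨hxA, f, hf, hne⟩
      obtain ⟨K, ψ, B, N, hN, hK, hB, hAN⟩ := exists_param_of_fderiv_ne_zero (k := k + 1)
        (by simp) (hf x hxA).2 (fun a ha => (hf a ha).1) hne
      have hlt : Module.finrank ℝ K < d := by lia
      exact ⟨N, hN, ((ihd _ hlt K rfl B).image (by simp) hlt.le hB).mono hAN⟩
    choose! N hN hNc using hreg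
    obtain ⟨t, htR, htc, ht⟩ := TopologicalSpace.countable_cover_nhdsWithin
      (s := R) (f := N) fun x hx => mem_nhdsWithin_of_mem_nhds (hN x hx)
    have : Countable t := htc
    refine (hsing.union (FlatCover.iUnion fun x : t => hNc x (htR x.2))).mono fun a ha => ?_
    by_cases haR : a ∈ R
    · obtain ⟨x, hx, hax⟩ := Set.mem_iUnion₂.1 (ht haR)
      exact Or.inr (Set.mem_iUnion.2 ⟨⟨x, hx⟩, ha, hax⟩)
    · exact Or.inl ⟨ha, haR⟩

/-- **Morse–Sard theorem** for real functions: the critical values of a `C^p` function on a space of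
dimension at most `p` form a null set. -/
theorem volume_image_critical_eq_zero {E : Type} [NormedAddCommGroup E] [NormedSpace ℝ E]
    [FiniteDimensional ℝ E] {p : ℕ} (hp : 1 ≤ p) (hE : Module.finrank ℝ E ≤ p) (f : E → ℝ)
    (A : Set E) (hf : ∀ a ∈ A, ContDiffAt ℝ p f a ∧ fderiv ℝ f a = 0) :
    volume (f '' A) = 0 := by
  obtain ⟨k, rfl⟩ : ∃ k, p = k + 1 := ⟨p - 1, by lia⟩
  obtain ⟨J, hJ, m, ψ, B, hm, hc, h⟩ := flatCover_self k _ E rfl A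
  refine measure_mono_null (Set.image_mono hc) ?_
  rw [Set.image_iUnion]
  refine measure_iUnion_null fun i => ?_
  rw [← Set.image_comp]
  refine volume_image_eq_zero_of_isLittleO_pow _ _ fun x hx => ?_
  obtain ⟨h1, h2, h3⟩ := h i x hx
  have := isLittleO_pow_succ_of_fderiv h1 ((hf _ h2).1.of_le (by simp)) (h3 _ (fderiv ℝ f)
    fun a ha => ⟨(hf a ha).2, (hf a ha).1.fderiv_right (by simp)⟩)
  -- The bound on the dimension enters here: `m i ≤ k + 1`, so near `x` the order `k + 1` is at
  -- least as good as the order `m i`.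
  refine this.trans_isBigO (Asymptotics.IsBigO.of_bound 1 ?_)
  filter_upwards [Metric.ball_mem_nhds x one_pos] with y hy
  rw [one_mul, norm_pow, norm_pow, norm_norm]
  exact pow_le_pow_of_le_one (norm_nonneg _) (by rw [← dist_eq_norm]; exact (Metric.mem_ball.1 hy).le)
    ((hm i).trans hE)

end Morse

/-! ### Tangent vectors in charts -/

section TangentSpace

variable {E : Type*} [NormedAddCommGroup E] [NormedSpace ℝ E] {p : ℕ} {M : Set E}
  {φ : OpenPartialHomeomorph E E} {V : Submodule ℝ E} {y : E}

/-- The velocity of a curve in a closed subspace belongs to this subspace. -/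
theorem deriv_mem_of_eventually_mem {F : Type*} [NormedAddCommGroup F] [NormedSpace ℝ F]
    {V : Submodule ℝ F} (hV : IsClosed (V : Set F)) {g : ℝ → F} {v : F} (hg : HasDerivAt g v 0)
    (h : ∀ᶠ t in 𝓝 (0 : ℝ), g t ∈ V) : v ∈ V := by
  refine hV.mem_of_tendsto hg.tendsto_slope ?_
  filter_upwards [h.filter_mono nhdsWithin_le_nhds] with t ht
  rw [slope_def_module]
  exact V.smul_mem _ (V.sub_mem ht h.self_of_nhds)

theorem exists_curve_of_chart (hφ' : DifferentiableAt ℝ φ.symm (φ y))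
    (hM : ∀ y ∈ φ.source, φ y ∈ V ↔ y ∈ M) (hys : y ∈ φ.source) (hy : y ∈ M) {a : E}
    (ha : a ∈ V) : ∃ c : ℝ → E, c 0 = y ∧ (∀ᶠ t in 𝓝 (0 : ℝ), c t ∈ M) ∧
      HasDerivAt c (fderiv ℝ φ.symm (φ y) a) 0 := by
  have hl : HasDerivAt (fun t : ℝ => φ y + t • a) a 0 := by
    simpa using ((hasDerivAt_id (0 : ℝ)).smul_const a).const_add (φ y)
  have hl0 : φ y + (0 : ℝ) • a = φ y := by simp
  refine ⟨fun t => φ.symm (φ y + t • a), by simp [φ.left_inv hys], ?_, ?_⟩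
  · have : ∀ᶠ t in 𝓝 (0 : ℝ), φ y + t • a ∈ φ.target :=
      hl.continuousAt.eventually_mem (by
        rw [hl0]; exact φ.open_target.mem_nhds (φ.map_source hys))
    filter_upwards [this] with t ht
    refine (hM _ (φ.map_target ht)).1 ?_
    rw [φ.right_inv ht]
    exact V.add_mem ((hM y hys).2 hy) (V.smul_mem _ ha)
  · have : HasFDerivAt φ.symm (fderiv ℝ φ.symm (φ y)) (φ y + (0 : ℝ) • a) := by
      rw [hl0]; exact hφ'.hasFDerivAt
    exact this.comp_hasDerivAt 0 hl

theorem fderiv_symm_mem_tangentSpace (hφ' : DifferentiableAt ℝ φ.symm (φ y))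
    (hM : ∀ y ∈ φ.source, φ y ∈ V ↔ y ∈ M) (hys : y ∈ φ.source) (hy : y ∈ M) {a : E}
    (ha : a ∈ V) : fderiv ℝ φ.symm (φ y) a ∈ tangentSpace M y :=
  Submodule.subset_span (exists_curve_of_chart hφ' hM hys hy ha)

theorem fderiv_symm_fderiv (hφ : DifferentiableAt ℝ φ y) (hφ' : DifferentiableAt ℝ φ.symm (φ y))
    (hys : y ∈ φ.source) (v : E) : fderiv ℝ φ.symm (φ y) (fderiv ℝ φ y v) = v := by
  have h := hφ'.hasFDerivAt.comp y hφ.hasFDerivAt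
  have h' : HasFDerivAt (φ.symm ∘ φ) (ContinuousLinearMap.id ℝ E) y :=
    (hasFDerivAt_id y).congr_of_eventuallyEq (φ.eventually_left_inverse hys)
  exact congrArg (fun L : E →L[ℝ] E => L v) (h.unique h')

theorem fderiv_fderiv_symm (hφ : DifferentiableAt ℝ φ y) (hφ' : DifferentiableAt ℝ φ.symm (φ y))
    (hys : y ∈ φ.source) (a : E) : fderiv ℝ φ y (fderiv ℝ φ.symm (φ y) a) = a := by
  have := fderiv_symm_fderiv (φ := φ.symm) (y := φ y) hφ' (by simpa [φ.left_inv hys] using hφ)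
    (φ.map_source hys) a
  simpa [φ.left_inv hys] using this

theorem contDiffAt_chart (hp : 1 ≤ p) (h : ContDiffOn ℝ p φ φ.source) (hy : y ∈ φ.source) :
    ContDiffAt ℝ p φ y ∧ DifferentiableAt ℝ φ y := by
  have := h.contDiffAt (φ.open_source.mem_nhds hy)
  exact ⟨this, this.differentiableAt (by simp; lia)⟩

end TangentSpace

theorem tendsto_clm_apply {E F X : Type*} [NormedAddCommGroup E] [NormedSpace ℝ E]
    [NormedAddCommGroup F] [NormedSpace ℝ F] {l : Filter X} {P : X → E →L[ℝ] F} {v : X → E}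
    {P₀ : E →L[ℝ] F} {v₀ : E} (hP : Tendsto P l (𝓝 P₀)) (hv : Tendsto v l (𝓝 v₀)) :
    Tendsto (fun x => P x (v x)) l (𝓝 (P₀ v₀)) :=
  (isBoundedBilinearMap_apply.continuous.tendsto (P₀, v₀)).comp (hP.prodMk_nhds hv)

/-! ### Limits of normal vectors and Whitney-(a) -/

section Orthogonal

variable {E : Type*} [NormedAddCommGroup E] [InnerProductSpace ℝ E] {p : ℕ} {M : Set E}

/-- Limits of normal vectors to a `C¹` submanifold are normal vectors. -/
theorem mem_tangentSpace_orthogonal_of_tendsto [FiniteDimensional ℝ E] (hp : 1 ≤ p)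
    (hM : IsSubmanifold p M) {x z : E}
    (hx : x ∈ M) {u v : ℕ → E} (hu : ∀ k, u k ∈ M) (hux : Tendsto u atTop (𝓝 x))
    (hv : ∀ k, v k ∈ (tangentSpace M (u k))ᗮ) (hvz : Tendsto v atTop (𝓝 z)) :
    z ∈ (tangentSpace M x)ᗮ := by
  obtain ⟨d, hd⟩ := hM
  obtain ⟨φ, V, hxs, hφ, hφ', -, hV⟩ := hd x hx
  suffices tangentSpace M x ≤ (Submodule.span ℝ {z})ᗮ from
    (Submodule.le_orthogonal_iff_le_orthogonal.1 this) (Submodule.mem_span_singleton_self z)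
  refine Submodule.span_le.2 ?_
  rintro w ⟨c, hc0, hcM, hcd⟩
  rw [SetLike.mem_coe, Submodule.mem_orthogonal_singleton_iff_inner_right]
  have hx' := contDiffAt_chart hp hφ hxs
  have hxt := contDiffAt_chart (φ := φ.symm) hp hφ' (φ.map_source hxs)
  set a := fderiv ℝ φ x w with ha
  have haV : a ∈ V := by
    have hcd' : HasDerivAt (fun t => φ (c t)) a 0 := by
      have : HasFDerivAt φ (fderiv ℝ φ x) (c 0) := by rw [hc0]; exact hx'.2.hasFDerivAt
      exact this.comp_hasDerivAt 0 hcd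
    refine deriv_mem_of_eventually_mem V.closed_of_finiteDimensional hcd' ?_
    have : ∀ᶠ t in 𝓝 (0 : ℝ), c t ∈ φ.source := hcd.continuousAt.eventually_mem
      (by rw [hc0]; exact φ.open_source.mem_nhds hxs)
    filter_upwards [this, hcM] with t ht ht' using (hV _ ht).2 ht'
  -- Keeping the chart coordinate `a` of `w` fixed extends `w` to tangent vectors at the nearby
  -- points `u k`.
  have hlim : Tendsto (fun k => fderiv ℝ φ.symm (φ (u k)) a) atTop (𝓝 w) := by
    have h1 : ContinuousAt (fderiv ℝ φ.symm) (φ x) :=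
      (hxt.1.fderiv_right (m := 0) (by simpa using hp)).continuousAt
    have h2 := tendsto_clm_apply (h1.tendsto.comp (hx'.1.continuousAt.tendsto.comp hux))
      (tendsto_const_nhds (x := a))
    rwa [ha, fderiv_symm_fderiv hx'.2 hxt.2 hxs] at h2
  refine tendsto_nhds_unique (hvz.inner hlim) (tendsto_const_nhds.congr' ?_)
  filter_upwards [hux.eventually_mem (φ.open_source.mem_nhds hxs)] with k hk
  exact ((Submodule.mem_orthogonal' _ _).1 (hv k) _ (fderiv_symm_mem_tangentSpace
    (contDiffAt_chart (φ := φ.symm) hp hφ' (φ.map_source hk)).2 hV hk (hu k) haV)).symm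

/-- A unit vector of `V` is compared with its projection to `W`. Norm convergence of projections
thus implies gap convergence. -/
theorem semiGap_le (V W : Submodule ℝ E) [V.HasOrthogonalProjection]
    [W.HasOrthogonalProjection] : semiGap V W ≤ ‖V.starProjection - W.starProjection‖ := by
  refine Real.iSup_le (fun v => ?_) (norm_nonneg _)
  obtain ⟨v, hv, hv1⟩ := v
  calc Metric.infDist v (W : Set E) ≤ dist v (W.starProjection v) :=
        Metric.infDist_le_dist_of_mem (W.starProjection_apply_mem v)
    _ = ‖(V.starProjection - W.starProjection) v‖ := by
        rw [dist_eq_norm, sub_apply, V.starProjection_eq_self_iff.2 hv]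
    _ ≤ ‖V.starProjection - W.starProjection‖ * ‖v‖ := ContinuousLinearMap.le_opNorm _ _
    _ = _ := by rw [hv1, mul_one]

/-- Sequential compactness of the Grassmannian, together with limits of normal vectors. -/
theorem exists_subseq_gap_tendsto [FiniteDimensional ℝ E] (V : ℕ → Submodule ℝ E) {v : ℕ → E} {z : E}
    (hv : ∀ k, v k ∈ (V k)ᗮ) (hvz : Tendsto v atTop (𝓝 z)) :
    ∃ (T : Submodule ℝ E) (σ : ℕ → ℕ), StrictMono σ ∧
      Tendsto (fun k => gap (V (σ k)) T) atTop (𝓝 0) ∧ z ∈ Tᗮ := by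
  obtain ⟨P, -, σ, hσ, hP⟩ := (isCompact_closedBall (0 : E →L[ℝ] E) 1).tendsto_subseq
    (x := fun k => (V k).starProjection)
    (fun k => mem_closedBall_zero_iff.2 (V k).starProjection_norm_le)
  have happ : ∀ x, Tendsto (fun k => (V (σ k)).starProjection x) atTop (𝓝 (P x)) := fun x =>
    tendsto_clm_apply hP tendsto_const_nhds
  -- Idempotence and symmetry survive the limit, so `P` is the orthogonal projection onto its range,
  -- which serves as the limit space.
  have hPP : IsStarProjection P := by
    refine ⟨?_, ?_⟩
    · ext x
      have h1 := tendsto_clm_apply hP (happ x)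
      refine tendsto_nhds_unique h1 ((happ x).congr fun k => ?_)
      exact ((V (σ k)).starProjection_eq_self_iff.2
        ((V (σ k)).starProjection_apply_mem x)).symm
    · rw [ContinuousLinearMap.isSelfAdjoint_iff_isSymmetric]
      intro x y
      refine tendsto_nhds_unique ((happ x).inner tendsto_const_nhds)
        ((tendsto_const_nhds.inner (happ y)).congr fun k => ?_)
      exact ((V (σ k)).inner_starProjection_left_eq_right x y).symm
  have hPT : P.range.starProjection = P := by
    obtain ⟨_, h⟩ := isStarProjection_iff_eq_starProjection_range.1 hPP
    exact h.symm
  refine ⟨P.range, σ, hσ, ?_, ?_⟩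
  · have h0 : Tendsto (fun k => ‖(V (σ k)).starProjection - P‖) atTop (𝓝 0) := by
      simpa using (hP.sub_const P).norm
    refine squeeze_zero (fun k => ?_) (fun k => ?_) h0
    · exact le_max_of_le_left (Real.iSup_nonneg fun _ => Metric.infDist_nonneg)
    · refine max_le ?_ ?_
      · simpa only [hPT] using semiGap_le (V (σ k)) P.range
      · simpa only [hPT, norm_sub_rev P] using semiGap_le P.range (V (σ k))
  · have hz : P z = 0 := by
      refine tendsto_nhds_unique (tendsto_clm_apply hP (hvz.comp hσ.tendsto_atTop))
        (tendsto_const_nhds.congr fun k => ?_)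
      exact ((V (σ k)).starProjection_apply_eq_zero_iff.2 (hv (σ k))).symm
    rwa [← hPT, Submodule.starProjection_apply_eq_zero_iff] at hz

/-- Limits of normal vectors to the strata of a Whitney stratification are normal vectors. -/
theorem IsWhitneyStratification.mem_orthogonal_of_tendsto [FiniteDimensional ℝ E]
    {ι : Type*} (hp : 1 ≤ p) {S : ι → Set E}
    {A : Set E} (hS : IsWhitneyStratification p S A) {j : ι} {x z : E} (hx : x ∈ S j)
    {u v : ℕ → E} {i : ℕ → ι} (hu : ∀ k, u k ∈ S (i k)) (hux : Tendsto u atTop (𝓝 x))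
    (hv : ∀ k, v k ∈ (tangentSpace (S (i k)) (u k))ᗮ) (hvz : Tendsto v atTop (𝓝 z)) :
    z ∈ (tangentSpace (S j) x)ᗮ := by
  -- By local finiteness only finitely many strata matter near `x`, so one recurs infinitely often.
  -- Whitney-(a) handles it if it differs from `S j`, and the `C¹` structure if not.
  obtain ⟨i₀, hi₀⟩ : ∃ i₀, ∃ᶠ k in atTop, i k = i₀ := by
    obtain ⟨N, hN, hfin⟩ := hS.1.locallyFinite x
    by_contra! hcon
    have h1 : ∀ᶠ k in atTop, ∀ l ∈ {l | (S l ∩ N).Nonempty}, i k ≠ l :=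
      (eventually_all_finite hfin).2 fun l _ => hcon l
    obtain ⟨k, hk, hk'⟩ := (h1.and (hux.eventually_mem hN)).exists
    exact hk (i k) ⟨u k, hu k, hk'⟩ rfl
  obtain ⟨σ, hσ, hσi⟩ := extraction_of_frequently_atTop hi₀
  have hu' : ∀ k, u (σ k) ∈ S i₀ := fun k => hσi k ▸ hu (σ k)
  have hv' : ∀ k, v (σ k) ∈ (tangentSpace (S i₀) (u (σ k)))ᗮ := fun k => hσi k ▸ hv (σ k)
  have hux' := hux.comp hσ.tendsto_atTop
  have hvz' := hvz.comp hσ.tendsto_atTop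
  by_cases hij : i₀ = j
  · subst hij
    exact mem_tangentSpace_orthogonal_of_tendsto hp (hS.1.isSubmanifold _) hx hu' hux' hv' hvz'
  · obtain ⟨T, τ, hτ, hgap, hzT⟩ := exists_subseq_gap_tendsto _ hv' hvz'
    refine Submodule.orthogonal_le ?_ hzT
    exact hS.2 i₀ j hij x ⟨mem_closure_of_tendsto hux' (Eventually.of_forall hu'), hx⟩
      (fun k => u (σ (τ k))) T (fun k => hu' _) (hux'.comp hτ.tendsto_atTop) hgap

end Orthogonal

variable {n : ℕ}

/-! Shortcut instances, without which unification on `RnR n` is very slow. -/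

noncomputable local instance : AddCommGroup (RnR n) := NormedAddCommGroup.toAddCommGroup
noncomputable local instance : Module ℝ (RnR n) := NormedSpace.toModule
noncomputable local instance : TopologicalSpace (RnR n) :=
  PseudoMetricSpace.toUniformSpace.toTopologicalSpace
local instance : ContinuousSMul ℝ (RnR n) := IsBoundedSMul.continuousSMul

theorem inner_RnR (x y : RnR n) : inner ℝ x y = inner ℝ x.fst y.fst + x.snd * y.snd := by
  rw [WithLp.prod_inner_apply]
  exact congrArg₂ _ rfl (mul_comm _ _)

theorem RnR_ext {x y : RnR n} (h : x.fst = y.fst) (h' : x.snd = y.snd) : x = y :=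
  WithLp.ofLp_injective 2 (Prod.ext h h')

theorem mem_graph_iff {f : Rn n → EReal} {u : RnR n} :
    u ∈ graph f ↔ f u.fst = ((u.snd : ℝ) : EReal) := Iff.rfl

theorem graphPoint_fst_of_mem {f : Rn n → EReal} {u : RnR n} (hu : u ∈ graph f) :
    graphPoint f u.fst = u := by
  rw [mem_graph_iff] at hu
  rw [graphPoint, hu, EReal.toReal_coe]
  rfl

theorem coe_toReal_of_mem_dom {f : Rn n → EReal} (hf : ∀ x, f x ≠ ⊥) {x : Rn n} (hx : x ∈ dom f) :
    ((f x).toReal : EReal) = f x := EReal.coe_toReal (ne_of_lt hx) (hf x)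

theorem graphPoint_mem_graph {f : Rn n → EReal} (hf : ∀ x, f x ≠ ⊥) {x : Rn n} (hx : x ∈ dom f) :
    graphPoint f x ∈ graph f := (coe_toReal_of_mem_dom hf hx).symm

theorem hasDerivAt_fst {γ : ℝ → RnR n} {v : RnR n} {t : ℝ} (h : HasDerivAt γ v t) :
    HasDerivAt (fun t => (γ t).fst) v.fst t :=
  (WithLp.fstL 2 ℝ (Rn n) ℝ).hasFDerivAt.comp_hasDerivAt t h

theorem hasDerivAt_snd {γ : ℝ → RnR n} {v : RnR n} {t : ℝ} (h : HasDerivAt γ v t) :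
    HasDerivAt (fun t => (γ t).snd) v.snd t :=
  (WithLp.sndL 2 ℝ (Rn n) ℝ).hasFDerivAt.comp_hasDerivAt t h

theorem hasDerivAt_toLp {c : ℝ → Rn n} {g : ℝ → ℝ} {w : Rn n} {τ t : ℝ} (hc : HasDerivAt c w t)
    (hg : HasDerivAt g τ t) :
    HasDerivAt (fun t => (WithLp.toLp 2 (c t, g t) : RnR n)) (WithLp.toLp 2 (w, τ)) t :=
  (WithLp.prodContinuousLinearEquiv 2 ℝ (Rn n) ℝ).symm.hasFDerivAt.comp_hasDerivAt t
    (hc.prodMk hg)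

/-! ### Curves in a stratum and in its projection -/

section Curves

variable {f : Rn n → EReal} {S : Set (RnR n)} {u : RnR n}

/-- The projection of a curve in a stratum. -/
theorem isCurve_fst (hS : S ⊆ graph f) {γ : ℝ → RnR n} {v : RnR n} (h0 : γ 0 = u)
    (hγ : ∀ᶠ t in 𝓝 (0 : ℝ), γ t ∈ S) (hd : HasDerivAt γ v 0) :
    IsCurve f S u.fst (fun t => (γ t).fst) v.fst ∧
      (fun t => (f (γ t).fst).toReal) =ᶠ[𝓝 0] fun t => (γ t).snd := by
  have he : (fun t => (f (γ t).fst).toReal) =ᶠ[𝓝 0] fun t => (γ t).snd := by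
    filter_upwards [hγ] with t ht
    rw [mem_graph_iff.1 (hS ht), EReal.toReal_coe]
  exact ⟨⟨by rw [h0], hγ.mono fun t ht => ⟨_, ht, rfl⟩, hasDerivAt_fst hd,
    (hasDerivAt_snd hd).continuousAt.congr he.symm⟩, he⟩

theorem graphPoint_curve_mem (hS : S ⊆ graph f) {x w : Rn n} {c : ℝ → Rn n}
    (hc : IsCurve f S x c w) : ∀ᶠ t in 𝓝 (0 : ℝ), graphPoint f (c t) ∈ S := by
  filter_upwards [hc.mem] with t ht
  obtain ⟨v, hv, hvt⟩ := ht
  rw [← hvt]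
  rwa [graphPoint_fst_of_mem (hS hv)]

/-- The projection of a transversal stratum to `ℝⁿ` is an immersion. -/
theorem ker_fst_comp_fderiv_symm {φ : OpenPartialHomeomorph (RnR n) (RnR n)}
    {V : Submodule ℝ (RnR n)} (h1 : DifferentiableAt ℝ φ u)
    (h2 : DifferentiableAt ℝ φ.symm (φ u)) (hV : ∀ y ∈ φ.source, φ y ∈ V ↔ y ∈ S)
    (hus : u ∈ φ.source) (hu : u ∈ S) (hH : lastVec n ∉ tangentSpace S u) :
    LinearMap.ker (((WithLp.fstL 2 ℝ (Rn n) ℝ).comp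
      ((fderiv ℝ φ.symm (φ u)).comp V.subtypeL) : V →L[ℝ] Rn n) : V →ₗ[ℝ] Rn n) = ⊥ := by
  set D := fderiv ℝ φ.symm (φ u) with hD
  refine LinearMap.ker_eq_bot'.2 fun a ha => ?_
  have hfst : (D a).fst = 0 := ha
  have hmem : D a ∈ tangentSpace S u := fderiv_symm_mem_tangentSpace h2 hV hus hu a.2
  have hDa : D a = (D a).snd • lastVec n := by
    refine RnR_ext ?_ ?_
    · simpa [lastVec] using hfst
    · simp [lastVec]
  have hsnd : (D a).snd = 0 := by
    by_contra hne
    rw [hDa] at hmem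
    exact hH (((tangentSpace S u).smul_mem_iff hne).1 hmem)
  rw [hsnd, zero_smul] at hDa
  have := fderiv_fderiv_symm h1 h2 hus (a : RnR n)
  rw [← hD, hDa, (fderiv ℝ φ u).map_zero] at this
  exact Subtype.ext this.symm

/-- Along a curve in the projection of a transversal stratum, `f` is differentiable. -/
theorem IsCurve.exists_hasDerivAt {p : ℕ} (hp : 1 ≤ p) (hM : IsSubmanifold p S) (hS : S ⊆ graph f)
    {x w : Rn n} (hx : graphPoint f x ∈ S) (hH : lastVec n ∉ tangentSpace S (graphPoint f x))
    {c : ℝ → Rn n} (hc : IsCurve f S x c w) :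
    ∃ τ, HasDerivAt (fun t => (f (c t)).toReal) τ 0 := by
  obtain ⟨d, hd⟩ := hM
  obtain ⟨φ, V, hus, hφ, hφ', -, hV⟩ := hd _ hx
  set u := graphPoint f x with hu
  have h1 := contDiffAt_chart hp hφ hus
  have h2 := contDiffAt_chart (φ := φ.symm) hp hφ' (φ.map_source hus)
  set D := fderiv ℝ φ.symm (φ u) with hD
  set L : V →L[ℝ] Rn n := (WithLp.fstL 2 ℝ (Rn n) ℝ).comp (D.comp V.subtypeL) with hL
  have hLker : LinearMap.ker (L : V →ₗ[ℝ] Rn n) = ⊥ :=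
    ker_fst_comp_fderiv_symm h1.2 h2.2 hV hus hx hH
  -- With a left inverse `B` of the immersion's derivative, `F` has derivative the identity at `a₀`.
  -- Its local inverse recovers the chart coordinates of the lifted curve `γ` differentiably from
  -- `c`.
  obtain ⟨B, hB⟩ := LinearMap.exists_leftInverse_of_injective _ hLker
  set B' : Rn n →L[ℝ] V := LinearMap.toContinuousLinearMap B with hB'
  set a₀ : V := ⟨φ u, (hV u hus).2 hx⟩ with ha₀
  set F : V → V := fun a => B' (φ.symm a).fst with hF
  have hFd : HasStrictFDerivAt F (ContinuousLinearEquiv.refl ℝ V : V →L[ℝ] V) a₀ := by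
    have hs : HasStrictFDerivAt φ.symm D (V.subtypeL a₀) :=
      h2.1.hasStrictFDerivAt (by simp; lia)
    have := (B'.comp (WithLp.fstL 2 ℝ (Rn n) ℝ)).hasStrictFDerivAt.comp a₀
      (hs.comp a₀ V.subtypeL.hasStrictFDerivAt)
    refine this.congr_fderiv (ContinuousLinearMap.ext fun a => ?_)
    exact congrArg (fun l : V →ₗ[ℝ] V => l a) hB
  set γ : ℝ → RnR n := fun t => graphPoint f (c t) with hγ
  have hγ0 : γ 0 = u := by rw [hγ, hu]; simp only [hc.map_zero]
  -- Continuity of `f ∘ c`, part of `IsCurve`, keeps the lift near `u`, where the chart and the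
  -- local inverse are valid.
  have hγc : ContinuousAt γ 0 :=
    (WithLp.prodContinuousLinearEquiv 2 ℝ (Rn n) ℝ).symm.continuous.continuousAt.comp
      (hc.hasDerivAt.continuousAt.prodMk hc.continuousAt)
  have hγS : ∀ᶠ t in 𝓝 (0 : ℝ), γ t ∈ S := graphPoint_curve_mem hS hc
  have hγs : ∀ᶠ t in 𝓝 (0 : ℝ), γ t ∈ φ.source :=
    hγc.eventually_mem (by rw [hγ0]; exact φ.open_source.mem_nhds hus)
  have hφγ : Tendsto (fun t => φ (γ t)) (𝓝 0) (𝓝 (φ u)) := by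
    have := h1.1.continuousAt
    rw [← hγ0] at this ⊢
    exact this.tendsto.comp hγc
  set G := hFd.localInverse with hG
  have hG' : ∀ᶠ t in 𝓝 (0 : ℝ), ((G (B' (c t)) : V) : RnR n) = φ (γ t) := by
    have hev : ∀ᶠ y in 𝓝 (φ u), ∀ hy : y ∈ V, G (F ⟨y, hy⟩) = ⟨y, hy⟩ := by
      have := hFd.eventually_left_inverse
      rw [nhds_subtype_eq_comap, eventually_comap] at this
      exact this.mono fun y hy hyV => hy ⟨y, hyV⟩ rfl
    filter_upwards [hφγ.eventually hev, hγS, hγs] with t h3 h4 h5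
    have hm := (hV _ h5).2 h4
    have := congrArg (fun v : V => (v : RnR n)) (h3 hm)
    simp only [hF, φ.left_inv h5] at this
    exact this
  have hF0 : F a₀ = B' (c 0) := by
    change B' (φ.symm (φ u)).fst = B' (c 0)
    rw [φ.left_inv hus, hc.map_zero]
    rfl
  have hGd : HasFDerivAt G ((ContinuousLinearEquiv.refl ℝ V).symm : V →L[ℝ] V) (B' (c 0)) := by
    rw [← hF0]
    exact hFd.to_localInverse.hasFDerivAt
  have hz : HasDerivAt (fun t => φ (γ t)) ((B' w : V) : RnR n) 0 := by
    have := V.subtypeL.hasFDerivAt.comp_hasDerivAt (0 : ℝ)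
      (hGd.comp_hasDerivAt 0 (B'.hasFDerivAt.comp_hasDerivAt 0 hc.hasDerivAt))
    exact this.congr_of_eventuallyEq (hG'.mono fun t ht => ht.symm)
  have hγd : HasDerivAt γ (D (B' w : V)) 0 := by
    have hs : HasFDerivAt φ.symm D (φ (γ 0)) := by rw [hγ0]; exact h2.2.hasFDerivAt
    refine (hs.comp_hasDerivAt 0 hz).congr_of_eventuallyEq ?_
    filter_upwards [hγs] with t ht using (φ.left_inv ht).symm
  exact ⟨_, hasDerivAt_snd hγd⟩

theorem IsCurve.toLp_mem_tangentSpace (hS : S ⊆ graph f) {x w : Rn n} {c : ℝ → Rn n}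
    (hc : IsCurve f S x c w) {τ : ℝ} (hτ : HasDerivAt (fun t => (f (c t)).toReal) τ 0) :
    (WithLp.toLp 2 (w, τ) : RnR n) ∈ tangentSpace S (graphPoint f x) := by
  refine Submodule.subset_span ⟨fun t => graphPoint f (c t), ?_, graphPoint_curve_mem hS hc,
    hasDerivAt_toLp hc.hasDerivAt hτ⟩
  simp only [hc.map_zero]

end Curves

/-! ### Existence and uniqueness of the gradient -/

section Gradient

variable {f : Rn n → EReal} {S : Set (RnR n)} {x : Rn n} {p : ℕ}

/-- A gradient yields the normal vector `(v, -1)` of the stratum. -/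
theorem IsRiemannianGradient.mem_orthogonal (hS : S ⊆ graph f) {v : Rn n}
    (hv : IsRiemannianGradient f S x v) :
    (WithLp.toLp 2 (v, -1) : RnR n) ∈ (tangentSpace S (graphPoint f x))ᗮ := by
  suffices tangentSpace S (graphPoint f x) ≤ (Submodule.span ℝ {WithLp.toLp 2 (v, -1)})ᗮ from
    (Submodule.le_orthogonal_iff_le_orthogonal.1 this) (Submodule.mem_span_singleton_self _)
  refine Submodule.span_le.2 ?_
  rintro w ⟨γ, h0, hγ, hd⟩
  rw [SetLike.mem_coe, Submodule.mem_orthogonal_singleton_iff_inner_right, inner_RnR]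
  obtain ⟨h1, h2⟩ := isCurve_fst hS h0 hγ hd
  have := ((hv.2 _ _ h1).congr_of_eventuallyEq h2.symm).unique (hasDerivAt_snd hd)
  simp [this]

/-- The difference is tangent and also orthogonal to every velocity. -/
theorem IsRiemannianGradient.unique {v v' : Rn n} (h' : IsRiemannianGradient f S x v)
    (h : IsRiemannianGradient f S x v') : v = v' := by
  have h1 : v - v' ∈ projTangentSpace f S x := Submodule.sub_mem _ h'.1 h.1
  have h2 : projTangentSpace f S x ≤ (Submodule.span ℝ {v - v'})ᗮ := by
    refine Submodule.span_le.2 ?_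
    rintro w ⟨c, hc⟩
    rw [SetLike.mem_coe, Submodule.mem_orthogonal_singleton_iff_inner_right, inner_sub_left,
      (h'.2 c w hc).unique (h.2 c w hc), sub_self]
  have h3 := Submodule.mem_orthogonal_singleton_iff_inner_right.1 (h2 h1)
  exact sub_eq_zero.1 (inner_self_eq_zero.1 h3)

/-- By (H) some normal `z` has a nonzero last coordinate. Orthogonality to a tangent vector `(w, τ)`
gives `τ = ⟨-z.fst / z.snd, w⟩`; projecting `-z.fst / z.snd` to the tangent space changes none of
these products. -/
theorem exists_isRiemannianGradient (hp : 1 ≤ p) (hM : IsSubmanifold p S) (hS : S ⊆ graph f)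
    (hx : graphPoint f x ∈ S) (hH : lastVec n ∉ tangentSpace S (graphPoint f x)) :
    ∃ v, IsRiemannianGradient f S x v := by
  set T := tangentSpace S (graphPoint f x) with hT
  obtain ⟨z, hz, hz1⟩ : ∃ z ∈ Tᗮ, z.snd ≠ 0 := by
    by_contra! h
    refine hH ?_
    rw [← Submodule.orthogonal_orthogonal T, Submodule.mem_orthogonal]
    intro z hz
    rw [inner_RnR]
    simp [h z hz, lastVec]
  set X := projTangentSpace f S x with hX
  refine ⟨X.starProjection (-(z.snd)⁻¹ • z.fst), X.starProjection_apply_mem _, fun c w hc => ?_⟩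
  obtain ⟨τ, hτ⟩ := hc.exists_hasDerivAt hp hM hS hx hH
  have hw : w ∈ X := Submodule.subset_span ⟨c, hc⟩
  have h0 := (Submodule.mem_orthogonal' _ _).1 hz _ (hc.toLp_mem_tangentSpace hS hτ)
  rw [inner_RnR] at h0
  convert! hτ using 1
  rw [X.inner_starProjection_left_eq_right, X.starProjection_eq_self_iff.2 hw, inner_smul_left]
  have h1 : inner ℝ z.fst w = - (z.snd * τ) := by
    have h0' : inner ℝ z.fst w + z.snd * τ = 0 := h0
    linarith
  rw [h1]
  simp
  field_simp

/-- If `(q, 0)` is normal to the stratum, then `q` is normal to its projection. -/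
theorem mem_projTangentSpace_orthogonal (hp : 1 ≤ p) (hM : IsSubmanifold p S) (hS : S ⊆ graph f)
    (hx : graphPoint f x ∈ S) (hH : lastVec n ∉ tangentSpace S (graphPoint f x)) {q : Rn n}
    (hq : (WithLp.toLp 2 (q, 0) : RnR n) ∈ (tangentSpace S (graphPoint f x))ᗮ) :
    q ∈ (projTangentSpace f S x)ᗮ := by
  suffices projTangentSpace f S x ≤ (Submodule.span ℝ {q})ᗮ from
    (Submodule.le_orthogonal_iff_le_orthogonal.1 this) (Submodule.mem_span_singleton_self _)
  refine Submodule.span_le.2 ?_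
  rintro w ⟨c, hc⟩
  rw [SetLike.mem_coe, Submodule.mem_orthogonal_singleton_iff_inner_right]
  obtain ⟨τ, hτ⟩ := hc.exists_hasDerivAt hp hM hS hx hH
  have := (Submodule.mem_orthogonal' _ _).1 hq _ (hc.toLp_mem_tangentSpace hS hτ)
  rw [inner_RnR] at this
  simpa using this

end Gradient

/-! ### Fréchet subgradients as normal vectors -/

section Subdifferentials

variable {f : Rn n → EReal} {S : Set (RnR n)} {x : Rn n} {p : ℕ}

/-- Real form of the extended-real lower limit, kept only where `f` is finite; this suffices along
curves in the graph. -/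
theorem frechetSubdiff_bound {xs : Rn n} (hxs : xs ∈ frechetSubdiff f x) {r ε : ℝ}
    (hr : f x = r) (hε : 0 < ε) :
    ∀ᶠ y in 𝓝 x, ∀ s : ℝ, f y = s → -ε * ‖y - x‖ ≤ s - r - inner ℝ xs (y - x) := by
  have hlt : ((-ε : ℝ) : EReal) < liminf (fun y : Rn n =>
      (f y - f x - ((inner ℝ xs (y - x) : ℝ) : EReal)) / ((‖y - x‖ : ℝ) : EReal)) (𝓝[≠] x) :=
    lt_of_lt_of_le (by exact_mod_cast neg_lt_zero.2 hε) hxs.2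
  have hev := eventually_lt_of_lt_liminf hlt
  rw [eventually_nhdsWithin_iff] at hev
  filter_upwards [hev] with y hy s hs
  by_cases hyx : y = x
  · subst hyx
    have : s = r := by exact_mod_cast hs.symm.trans hr
    simp [this]
  · have h1 := hy hyx
    rw [hs, hr, ← EReal.coe_sub, ← EReal.coe_sub, ← EReal.coe_div, EReal.coe_lt_coe_iff,
      lt_div_iff₀ (norm_pos_iff.2 (sub_ne_zero.2 hyx))] at h1
    exact h1.le

/-- A Fréchet subgradient yields the normal vector `(x*, -1)` of the stratum. -/
theorem mem_orthogonal_of_mem_frechetSubdiff (hS : S ⊆ graph f) (hx : graphPoint f x ∈ S)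
    {xs : Rn n} (hxs : xs ∈ frechetSubdiff f x) :
    (WithLp.toLp 2 (xs, -1) : RnR n) ∈ (tangentSpace S (graphPoint f x))ᗮ := by
  suffices tangentSpace S (graphPoint f x) ≤ (Submodule.span ℝ {WithLp.toLp 2 (xs, -1)})ᗮ from
    (Submodule.le_orthogonal_iff_le_orthogonal.1 this) (Submodule.mem_span_singleton_self _)
  have hr : f x = ((f x).toReal : EReal) := hS hx
  -- Times `t > 0` give one inequality; the reversed curve `t ↦ γ (-t)` gives the opposite one,
  -- hence orthogonality.
  have key : ∀ (γ : ℝ → RnR n) (v : RnR n), γ 0 = graphPoint f x → (∀ᶠ t in 𝓝 (0 : ℝ), γ t ∈ S) →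
      HasDerivAt γ v 0 → 0 ≤ v.snd - inner ℝ xs v.fst := by
    intro γ v h0 hγ hd
    have hd1 := hasDerivAt_fst hd
    have h01 : (γ 0).fst = x := by rw [h0]; rfl
    have h02 : (γ 0).snd = (f x).toReal := by rw [h0]; rfl
    have s1 := hd1.tendsto_slope_zero_right
    have s2 := (hasDerivAt_snd hd).tendsto_slope_zero_right
    simp only [zero_add, h01, h02] at s1 s2
    have hle : ∀ ε : ℝ, 0 < ε → -ε * ‖v.fst‖ ≤ v.snd - inner ℝ xs v.fst := by
      intro ε hε
      refine le_of_tendsto_of_tendsto (s1.norm.const_mul (-ε))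
        (s2.sub (tendsto_const_nhds.inner s1)) ?_
      have hcx : Tendsto (fun t => (γ t).fst) (𝓝 0) (𝓝 x) := by
        have := hd1.continuousAt.tendsto
        rwa [h01] at this
      filter_upwards [(hcx.eventually (frechetSubdiff_bound hxs hr hε)).filter_mono
        nhdsWithin_le_nhds, hγ.filter_mono nhdsWithin_le_nhds, self_mem_nhdsWithin] with t ht1 ht2 ht3
      have := ht1 _ (hS ht2)
      have ht : (0 : ℝ) < t⁻¹ := inv_pos.2 ht3
      rw [norm_smul, inner_smul_right, Real.norm_of_nonneg ht.le, smul_eq_mul]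
      have := mul_le_mul_of_nonneg_left this ht.le
      linarith
    have hlim : Tendsto (fun ε : ℝ => -ε * ‖v.fst‖) (𝓝[>] 0) (𝓝 0) := by
      have : Continuous fun ε : ℝ => -ε * ‖v.fst‖ := by fun_prop
      simpa using (this.tendsto 0).mono_left nhdsWithin_le_nhds
    exact le_of_tendsto hlim (eventually_mem_nhdsWithin.mono fun ε hε => hle ε hε)
  refine Submodule.span_le.2 ?_
  rintro v ⟨γ, h0, hγ, hd⟩
  rw [SetLike.mem_coe, Submodule.mem_orthogonal_singleton_iff_inner_right, inner_RnR]
  have h1 := key γ v h0 hγ hd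
  have hneg : HasDerivAt (fun t : ℝ => γ (-t)) (-v) 0 := by
    have : HasDerivAt γ v (-0) := by rwa [neg_zero]
    have := this.scomp (0 : ℝ) (hasDerivAt_neg (0 : ℝ))
    rwa [neg_smul, one_smul] at this
  have hγ' : ∀ᶠ t in 𝓝 (0 : ℝ), γ (-t) ∈ S := by
    have : Tendsto (fun t : ℝ => -t) (𝓝 0) (𝓝 0) := by simpa using (continuous_neg.tendsto (0 : ℝ))
    exact this.eventually hγ
  have h2 := key (fun t => γ (-t)) (-v) (by simpa using h0) hγ' hneg
  simp only [WithLp.neg_fst, WithLp.neg_snd, inner_neg_right] at h2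
  change inner ℝ xs v.fst + -1 * v.snd = 0
  linarith

end Subdifferentials

/-! ### The projection formula for Clarke subgradients -/

section Stratified

variable {f : Rn n → EReal} {p : ℕ} {ι : Type*} {S : ι → Set (RnR n)} {x : Rn n} {j : ι}

theorem IsWhitneyStratification.subset (hS : IsWhitneyStratification p S (graph f)) (i : ι) :
    S i ⊆ graph f := hS.1.iUnion_eq ▸ Set.subset_iUnion S i

/-- Rescaled limits of Fréchet subgradients yield normal vectors of the stratum. -/
theorem mem_orthogonal_of_tendsto_frechetSubdiff (hp : 1 ≤ p) (hf : ∀ x, f x ≠ ⊥)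
    (hS : IsWhitneyStratification p S (graph f)) (hxd : x ∈ dom f) (hx : graphPoint f x ∈ S j)
    {y ys : ℕ → Rn n} {t : ℕ → ℝ} (hys : ∀ k, ys k ∈ frechetSubdiff f (y k))
    (hy : Tendsto y atTop (𝓝 x)) (hfy : Tendsto (fun k => f (y k)) atTop (𝓝 (f x)))
    {q : Rn n} {s : ℝ} (hq : Tendsto (fun k => t k • ys k) atTop (𝓝 q))
    (hs : Tendsto t atTop (𝓝 s)) :
    (WithLp.toLp 2 (q, -s) : RnR n) ∈ (tangentSpace (S j) (graphPoint f x))ᗮ := by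
  have hex : ∀ k, ∃ i, graphPoint f (y k) ∈ S i := fun k => by
    have := graphPoint_mem_graph hf (hys k).1
    rwa [← hS.1.iUnion_eq, Set.mem_iUnion] at this
  choose i hi using hex
  have hcont := (WithLp.prodContinuousLinearEquiv 2 ℝ (Rn n) ℝ).symm.continuous
  -- Convergence of the values `f (y k)` is what makes the graph points converge.
  have hux : Tendsto (fun k => graphPoint f (y k)) atTop (𝓝 (graphPoint f x)) :=
    (hcont.tendsto _).comp (hy.prodMk_nhds ((EReal.tendsto_toReal (ne_of_lt hxd) (hf x)).comp hfy))
  refine hS.mem_orthogonal_of_tendsto hp hx (v := fun k => t k • WithLp.toLp 2 (ys k, -1)) hi hux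
    (fun k => Submodule.smul_mem _ _
      (mem_orthogonal_of_mem_frechetSubdiff (hS.subset _) (hi k) (hys k))) ?_
  refine ((hcont.tendsto _).comp (hq.prodMk_nhds hs.neg)).congr fun k => ?_
  refine RnR_ext ?_ ?_ <;> simp

/-- The projection formula: Clarke subgradients project to the Riemannian gradient. -/
theorem sub_mem_orthogonal_of_mem_clarkeSubdiff (hp : 1 ≤ p) (hf : ∀ x, f x ≠ ⊥)
    (hS : IsWhitneyStratification p S (graph f)) (hH : Transversal S)
    (hx : graphPoint f x ∈ S j) {v : Rn n} (hv : IsRiemannianGradient f (S j) x v) {xs : Rn n}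
    (hxs : xs ∈ clarkeSubdiff f x) : xs - v ∈ (projTangentSpace f (S j) x)ᗮ := by
  set X := projTangentSpace f (S j) x
  have hperp : ∀ {q : Rn n}, (WithLp.toLp 2 (q, 0) : RnR n) ∈
      (tangentSpace (S j) (graphPoint f x))ᗮ → q ∈ Xᗮ := fun hq =>
    mem_projTangentSpace_orthogonal hp (hS.1.isSubmanifold j) (hS.subset j) hx (hH j _ hx) hq
  have hlim : ∀ q ∈ limitingSubdiff f x, q - v ∈ Xᗮ := by
    rintro q ⟨hxd, y, ys, hys, hy, hfy, hq⟩
    have h1 := mem_orthogonal_of_tendsto_frechetSubdiff hp hf hS hxd hx (t := fun _ => 1) hys hy hfy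
      (by simpa using hq) tendsto_const_nhds
    have h2 := hv.mem_orthogonal (hS.subset j)
    -- Subtracting the normals `(q, -1)` and `(v, -1)` leaves `(q - v, 0)`.
    refine hperp ?_
    convert! Submodule.sub_mem _ h1 h2 using 1
    refine RnR_ext ?_ ?_ <;> simp
  have hasy : ∀ q ∈ asymptoticSubdiff f x, q ∈ Xᗮ := by
    rintro q ⟨hxd, y, ys, t, hys, -, -, ht, hy, hfy, hq⟩
    refine hperp ?_
    simpa using mem_orthogonal_of_tendsto_frechetSubdiff hp hf hS hxd hx hys hy hfy hq ht
  -- The translate `v + Xᗮ` is convex and closed, so it contains the closed convex hull as well.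
  have hsub : limitingSubdiff f x + asymptoticSubdiff f x ⊆ {q | q - v ∈ Xᗮ} := by
    rintro _ ⟨a, ha, b, hb, rfl⟩
    have := Submodule.add_mem _ (hlim a ha) (hasy b hb)
    simpa [sub_add_eq_add_sub] using this
  have hconv : Convex ℝ {q : Rn n | q - v ∈ Xᗮ} := by
    have := Xᗮ.convex.translate_preimage_left (-v)
    simpa [← sub_eq_add_neg, Set.preimage] using this
  have hclosed : IsClosed {q : Rn n | q - v ∈ Xᗮ} :=
    X.isClosed_orthogonal.preimage (by fun_prop : Continuous fun q : Rn n => q - v)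
  exact closure_minimal (convexHull_min hsub hconv) hclosed hxs

/-- Since `v` is tangent and `xs - v` is normal, `‖v‖² = ⟨xs, v⟩`; Cauchy–Schwarz concludes. -/
theorem norm_gradient_le (hp : 1 ≤ p) (hf : ∀ x, f x ≠ ⊥)
    (hS : IsWhitneyStratification p S (graph f)) (hH : Transversal S)
    (hx : graphPoint f x ∈ S j) {v : Rn n} (hv : IsRiemannianGradient f (S j) x v) {xs : Rn n}
    (hxs : xs ∈ clarkeSubdiff f x) : ‖v‖ ≤ ‖xs‖ := by
  have h := (Submodule.mem_orthogonal' _ _).1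
    (sub_mem_orthogonal_of_mem_clarkeSubdiff hp hf hS hH hx hv hxs) v hv.1
  rw [inner_sub_left, real_inner_self_eq_norm_sq, sub_eq_zero] at h
  have h1 := real_inner_le_norm xs v
  rcases (norm_nonneg v).eq_or_lt with h0 | h0
  · rw [← h0]; exact norm_nonneg _
  · nlinarith

end Stratified

/-! ### Clarke critical values -/

section MorseSard

variable {f : Rn n → EReal} {p : ℕ}

/-- The heights of the points of a transversal submanifold with horizontal tangent space form a null
set. -/
theorem volume_snd_image_eq_zero {S : Set (RnR n)} (hp : 1 ≤ p) (hnp : n ≤ p)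
    (hM : IsSubmanifold p S) (hH : ∀ u ∈ S, lastVec n ∉ tangentSpace S u) :
    volume ((fun u : RnR n => u.snd) '' {u ∈ S | ∀ w ∈ tangentSpace S u, w.snd = 0}) = 0 := by
  set C := {u ∈ S | ∀ w ∈ tangentSpace S u, w.snd = 0} with hC
  obtain ⟨d, hd⟩ := hM
  have hloc : ∀ u ∈ C, ∃ N ∈ 𝓝 u, volume ((fun u : RnR n => u.snd) '' (C ∩ N)) = 0 := by
    intro u hu
    obtain ⟨φ, V, hus, hφ, hφ', -, hV⟩ := hd u hu.1
    refine ⟨φ.source, φ.open_source.mem_nhds hus, ?_⟩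
    have hφy : ∀ y ∈ φ.source, DifferentiableAt ℝ φ y := fun y hy => (contDiffAt_chart hp hφ hy).2
    have hφy' : ∀ y ∈ φ.source, ContDiffAt ℝ p φ.symm (φ y) ∧ DifferentiableAt ℝ φ.symm (φ y) :=
      fun y hy => contDiffAt_chart (φ := φ.symm) hp hφ' (φ.map_source hy)
    -- The stratum immerses in `ℝⁿ`, so its dimension is at most `n`, not merely `n + 1`.
    have hdim : Module.finrank ℝ V ≤ p := by
      have := LinearMap.finrank_le_finrank_of_injective (LinearMap.ker_eq_bot.1
        (ker_fst_comp_fderiv_symm (hφy u hus) (hφy' u hus).2 hV hus hu.1 (hH u hu.1)))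
      rw [finrank_euclideanSpace_fin] at this
      exact this.trans hnp
    set g : V → ℝ := fun a => (φ.symm a).snd with hg
    have hsub : (fun u : RnR n => u.snd) '' (C ∩ φ.source) ⊆
        g '' {a | ∃ y ∈ C ∩ φ.source, (a : RnR n) = φ y} := by
      rintro _ ⟨y, hy, rfl⟩
      exact ⟨⟨φ y, (hV y hy.2).2 hy.1.1⟩, ⟨y, hy, rfl⟩, by simp only [hg, φ.left_inv hy.2]⟩
    refine measure_mono_null hsub (volume_image_critical_eq_zero hp hdim g _ ?_)
    rintro a ⟨y, hy, hay⟩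
    obtain ⟨h1, h2⟩ := hφy' y hy.2
    have hsmul : (V.subtypeL a : RnR n) = φ y := hay
    constructor
    · refine (WithLp.sndL 2 ℝ (Rn n) ℝ).contDiff.contDiffAt.comp a
        (ContDiffAt.comp a ?_ V.subtypeL.contDiff.contDiffAt)
      rw [hay]
      exact h1
    · have hder : HasFDerivAt φ.symm (fderiv ℝ φ.symm (φ y)) (V.subtypeL a) := by
        rw [hsmul]; exact h2.hasFDerivAt
      have := (WithLp.sndL 2 ℝ (Rn n) ℝ).hasFDerivAt.comp a (hder.comp a V.subtypeL.hasFDerivAt)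
      refine HasFDerivAt.fderiv (this.congr_fderiv (ContinuousLinearMap.ext fun b => ?_))
      -- The derivative of the height in the chart is the last coordinate of a tangent vector, zero
      -- on `C`.
      exact hy.1.2 _ (fderiv_symm_mem_tangentSpace h2 hV hy.2 hy.1.1 b.2)
  choose! N hN hNc using hloc
  obtain ⟨t, htC, htc, ht⟩ := TopologicalSpace.countable_cover_nhdsWithin
    (s := C) (f := N) fun x hx => mem_nhdsWithin_of_mem_nhds (hN x hx)
  refine measure_mono_null ?_ ((measure_biUnion_null_iff htc).2 fun x hx => hNc x (htC hx))
  rintro _ ⟨y, hy, rfl⟩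
  obtain ⟨x, hx, hyx⟩ := Set.mem_iUnion₂.1 (ht hy)
  exact Set.mem_iUnion₂.2 ⟨x, hx, y, ⟨hy, hyx⟩, rfl⟩

theorem volume_clarkeCriticalValues_eq_zero {ι : Type*} {S : ι → Set (RnR n)} (hp : 1 ≤ p)
    (hnp : n ≤ p) (hf : ∀ x, f x ≠ ⊥) (hS : IsWhitneyStratification p S (graph f))
    (hH : Transversal S) : volume (clarkeCriticalValues f) = 0 := by
  -- A locally finite family of nonempty sets in a second-countable space is countable.
  have : Countable ι := Set.countable_univ_iff.1
    (hS.1.locallyFinite.countable_univ hS.1.nonempty)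
  refine measure_mono_null ?_ (measure_iUnion_null fun i =>
    volume_snd_image_eq_zero hp hnp (hS.1.isSubmanifold i) (hH i))
  rintro α ⟨x, hxα, h0⟩
  have hxg : graphPoint f x ∈ graph f :=
    graphPoint_mem_graph hf (show f x < ⊤ by rw [hxα]; exact EReal.coe_lt_top α)
  have hxg' := hxg
  rw [← hS.1.iUnion_eq, Set.mem_iUnion] at hxg'
  obtain ⟨i, hi⟩ := hxg'
  obtain ⟨v, hv⟩ := exists_isRiemannianGradient hp (hS.1.isSubmanifold i) (hS.subset i) hi
    (hH i _ hi)
  have hv0 : v = 0 := by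
    simpa using norm_gradient_le hp hf hS hH hi hv h0
  subst hv0
  refine Set.mem_iUnion.2 ⟨i, graphPoint f x, ⟨hi, fun w hw => ?_⟩, ?_⟩
  -- With zero gradient the normal `(v, -1)` is `(0, -1)`, so the tangent space is horizontal.
  · have := (Submodule.mem_orthogonal' _ _).1 (hv.mem_orthogonal (hS.subset i)) w hw
    rw [inner_RnR] at this
    simpa using this
  · change (f x).toReal = α
    rw [hxα, EReal.toReal_coe]

end MorseSard
end WhitneySard

theorem corollary3p1 {n p : ℕ} (hp : 1 ≤ p)
    (f : WhitneySard.Rn n → EReal) (hf : ∀ x, f x ≠ ⊥)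
    (hclosed : IsClosed (WhitneySard.graph f))
    {ι : Type*} (S : ι → Set (WhitneySard.RnR n))
    (hS : WhitneySard.IsWhitneyStratification p S (WhitneySard.graph f))
    (hH : WhitneySard.Transversal S) :
    (∀ x ∈ WhitneySard.dom f, ∀ i, WhitneySard.graphPoint f x ∈ S i →
      (∃! v, WhitneySard.IsRiemannianGradient f (S i) x v) ∧
      ∀ v, WhitneySard.IsRiemannianGradient f (S i) x v →
        ∀ xs ∈ WhitneySard.clarkeSubdiff f x, ‖v‖ ≤ ‖xs‖) ∧
    (n ≤ p → volume (WhitneySard.clarkeCriticalValues f) = 0) := by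
  refine ⟨fun x _ i hi => ⟨?_, fun v hv xs hxs =>
    WhitneySard.norm_gradient_le hp hf hS hH hi hv hxs⟩, fun hnp =>
    WhitneySard.volume_clarkeCriticalValues_eq_zero hp hnp hf hS hH⟩
  obtain ⟨v, hv⟩ := WhitneySard.exists_isRiemannianGradient hp (hS.1.isSubmanifold i) (hS.subset i)
    hi (hH i _ hi)
  exact ⟨v, hv, fun v' hv' => hv'.unique hv⟩
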